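/- A probability vector is a sequence $x=(x_i)_{i\in\mathbf N}$ of real numbers $x_i\ge 0$ with $\sum_i x_i=1$; it is finitely supported if only finitely many $x_i$ are non-zero. For real $p$ put $N_p(x)=\sum_{i:\,x_i>0}x_i^p\in[0,\infty]$, put $H(x)=-\sum_i x_i\log x_i\in[0,\infty]$ (with $0\log 0=0$), and write $\|x-y\|_1=\sum_i|x_i-y_i|$. For $n\ge 1$, $x^{\otimes n}$ is the vector with coordinates $x_{i_1}\cdots x_{i_n}$ indexed by $(i_1,\dots,i_n)\in\mathbf N^n$. The decreasing rearrangement $x^\downarrow$ of a probability vector $x$ (with any countable index set) is the non-increasing sequence $(x^\downarrow_i)_{i\ge 1}$ whose non-zero terms are, up to permutation, the non-zero components of $x$. We write $x\prec y$ if $\sum_{i=1}^k x^\downarrow_i\le\sum_{i=1}^k y^\downarrow_i$ for every $k\ge 1$. **Theorem.** Let $x,y$ be probability vectors such that $N_p(x)\le N_p(y)$ for every real $p\ge 1$ and $H(x)<\infty$. Then for every $\varepsilon>0$ there exist finitely supported probability vectors $x_\varepsilon,y_\varepsilon$ and an integer $n\ge 1$ such that $\|x-x_\varepsilon\|_1\le\varepsilon$,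 $\|y-y_\varepsilon\|_1\le\varepsilon$ and $x_\varepsilon^{\otimes n}\prec y_\varepsilon^{\otimes n}$. -/

import Mathlib

/-- `x` is a probability vector (possibly with infinite support): nonnegative coordinates with
sum one. A vector with finitely many coordinates is a vector on `ℕ`, padded with zeros. -/
structure IsProbVec {ι : Type*} (x : ι → ℝ) : Prop where
  nonneg : ∀ i, 0 ≤ x i
  hasSum_one : HasSum x 1

open Classical in
/-- `N_p(x)`, the sum of `x_i ^ p` over the indices with `x_i > 0`; it may be infinite. -/
noncomputable def powerSum {ι : Type*} (p : ℝ) (x : ι → ℝ) : ENNReal :=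
  ∑' i, if 0 < x i then ENNReal.ofReal (x i ^ p) else 0

/-- The Shannon entropy `H(x) = - ∑ x_i log x_i` (with `0 log 0 = 0`) of a probability vector;
it may be infinite. All the terms `Real.negMulLog (x i) = - x i * Real.log (x i)` are nonnegative,
because `0 ≤ x i ≤ 1`. -/
noncomputable def shannonEntropy {ι : Type*} (x : ι → ℝ) : ENNReal :=
  ∑' i, ENNReal.ofReal (Real.negMulLog (x i))

/-- The `ℓ₁` distance of two vectors (the series converges for probability vectors). -/
noncomputable def l1Dist {ι : Type*} (x y : ι → ℝ) : ℝ :=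
  ∑' i, |x i - y i|

/-- The tensor power `x^{⊗ n}`: its coordinates are the products `x_{i_1} ⋯ x_{i_n}`, indexed by
the multi-indices `(i_1, …, i_n)`. -/
def tensorPow {ι : Type*} (n : ℕ) (x : ι → ℝ) : (Fin n → ι) → ℝ :=
  fun i => ∏ j, x (i j)

/-- The sequence `z` is the decreasing rearrangement of `x`: it is nonincreasing, and its nonzero
components are those of `x` up to a permutation. Every probability vector `x` has exactly one. -/
structure IsDecreasingRearrangement {ι : Type*} (x : ι → ℝ) (z : ℕ → ℝ) : Prop where
  antitone : Antitone z
  perm : ∃ e : Function.support x ≃ Function.support z, ∀ i, z (e i) = x i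

/-- Majorization `x ≺ y` of probability vectors: every partial sum of the decreasing rearrangement
of `x` is at most the corresponding partial sum of that of `y`. -/
def Majorized {ι κ : Type*} (x : ι → ℝ) (y : κ → ℝ) : Prop :=
  ∃ x' y' : ℕ → ℝ, IsDecreasingRearrangement x x' ∧ IsDecreasingRearrangement y y' ∧
    ∀ k : ℕ, ∑ i ∈ Finset.range k, x' i ≤ ∑ i ∈ Finset.range k, y' i

open Finset

/-! For vectors of finite support, majorization follows once the mass carried by components at least
`s` is no larger for `x^{⊗n}` than for `y^{⊗n}`, for every `s > 0` (`majorized_of_tailSum_le`). With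
`s = exp (n t)` this mass is a large deviation probability for a sum of `n` independent copies of
`log x`, and it is computed by `wordTail`.

Chernoff's bound for `x` involves only the power sums of exponent at least 1, hence is dominated by
the same quantity for `y`. Exponential tilting, as in Cramér's theorem, shows that this quantity is
attained for `y` up to an arbitrarily small exponential factor and shift of threshold
(`eventually_pow_mul_wordTail_le`); a finite grid makes this uniform in the threshold
(`exists_forall_wordTail_le`).

The approximations supply the slack. Lumping the tail of `y` into one component only raises its
power sums. Multiplying the truncated `x` by `q < 1` gives both the factor `q ^ n` and the shift
(`wordTail_scale`). The missing mass goes into components so tiny that they matter only at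
thresholds where the tail sum for `y` is already 1. -/

/-! ### Weighted words and Chernoff bounds. -/

/-- The sum of the weights `∏ j, w (f j)` over the words `f` of length `n` in the alphabet `A` for
which the sum of the values `v (f j)` is nonnegative. -/
noncomputable def wordTail {ι : Type*} (A : Finset ι) (w v : ι → ℝ) (n : ℕ) : ℝ :=
  ∑ f ∈ Fintype.piFinset (fun _ : Fin n => A) with 0 ≤ ∑ j, v (f j), ∏ j, w (f j)

theorem sum_piFinset_prod {ι : Type*} (A : Finset ι) (w : ι → ℝ) (n : ℕ) :
    ∑ f ∈ Fintype.piFinset (fun _ : Fin n => A), ∏ j, w (f j) = (∑ i ∈ A, w i) ^ n := by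
  rw [Finset.sum_prod_piFinset]
  simp

theorem wordTail_nonneg {ι : Type*} (A : Finset ι) (w v : ι → ℝ) (hw : ∀ i ∈ A, 0 ≤ w i)
    (n : ℕ) : 0 ≤ wordTail A w v n :=
  sum_nonneg fun _ hf => prod_nonneg fun j _ =>
    hw _ (Fintype.mem_piFinset.1 (mem_filter.1 hf).1 j)

theorem wordTail_le_pow {ι : Type*} (A : Finset ι) (w v : ι → ℝ) (hw : ∀ i ∈ A, 0 ≤ w i)
    (n : ℕ) : wordTail A w v n ≤ (∑ i ∈ A, w i) ^ n := by
  rw [← sum_piFinset_prod]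
  refine sum_le_sum_of_subset_of_nonneg (filter_subset _ _) fun f hf _ => ?_
  exact prod_nonneg fun j _ => hw _ (Fintype.mem_piFinset.1 hf j)

/-- Chernoff's bound. -/
theorem wordTail_le_exp {ι : Type*} (A : Finset ι) (w v : ι → ℝ) (hw : ∀ i ∈ A, 0 ≤ w i)
    (n : ℕ) {s : ℝ} (hs : 0 ≤ s) :
    wordTail A w v n ≤ (∑ i ∈ A, w i * Real.exp (s * v i)) ^ n := by
  rw [← sum_piFinset_prod]
  have h1 : ∀ f ∈ Fintype.piFinset (fun _ : Fin n => A), 0 ≤ ∏ j, w (f j) := fun f hf =>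
    prod_nonneg fun j _ => hw _ (Fintype.mem_piFinset.1 hf j)
  have h2 : ∀ f : Fin n → ι, ∏ j, (w (f j) * Real.exp (s * v (f j))) =
      (∏ j, w (f j)) * Real.exp (s * ∑ j, v (f j)) := fun f => by
    rw [prod_mul_distrib, ← Real.exp_sum, mul_sum]
  unfold wordTail
  refine (sum_le_sum fun f hf => ?_).trans
    (sum_le_sum_of_subset_of_nonneg (filter_subset _ _) fun f hf _ => ?_)
  · rw [mem_filter] at hf
    rw [h2]
    exact le_mul_of_one_le_right (h1 f hf.1) (Real.one_le_exp (mul_nonneg hs hf.2))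
  · rw [h2]
    exact mul_nonneg (h1 f hf) (Real.exp_pos _).le

/-- Words with a nonnegative sum of values are exponentially rare if the mean value is negative. -/
theorem exists_wordTail_le_pow {ι : Type*} (A : Finset ι) (w v : ι → ℝ) (hw : ∀ i ∈ A, 0 ≤ w i)
    (h : ∑ i ∈ A, w i * v i < 0) :
    ∃ r : ℝ, 0 ≤ r ∧ r < ∑ i ∈ A, w i ∧ ∀ n, wordTail A w v n ≤ r ^ n := by
  set F : ℝ → ℝ := fun s => ∑ i ∈ A, w i * Real.exp (s * v i) with hF
  -- The mean is the derivative of `F` at 0, so some small `s > 0` brings `F` strictly below `F 0`,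
  -- the total weight.
  have hd : HasDerivAt F (∑ i ∈ A, w i * v i) 0 := by
    have : HasDerivAt F (∑ i ∈ A, w i * (Real.exp (0 * v i) * (1 * v i))) 0 :=
      HasDerivAt.fun_sum fun i _ => (((hasDerivAt_id (0 : ℝ)).mul_const (v i)).exp).const_mul (w i)
    simpa using this
  have hlt : ∀ᶠ s in nhdsWithin (0 : ℝ) (Set.Ioi 0), F s < F 0 := by
    have hsl := hd.hasDerivWithinAt (s := Set.Ioi 0)
    rw [hasDerivWithinAt_iff_tendsto_slope' (by simp)] at hsl
    filter_upwards [hsl.eventually_lt_const h, self_mem_nhdsWithin] with s hs hs0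
    rw [slope_def_field, sub_zero, div_neg_iff] at hs
    have : (0 : ℝ) < s := hs0
    rcases hs with hs | hs <;> linarith
  obtain ⟨s, hs, hs0⟩ := (hlt.and self_mem_nhdsWithin).exists
  refine ⟨F s, sum_nonneg fun i hi => mul_nonneg (hw i hi) (Real.exp_pos _).le, ?_, fun n =>
    wordTail_le_exp A w v hw n (le_of_lt hs0)⟩
  simpa [hF] using hs

theorem wordTail_mono {ι : Type*} (A : Finset ι) (w v v' : ι → ℝ) (hw : ∀ i ∈ A, 0 ≤ w i)
    (hv : ∀ i ∈ A, v i ≤ v' i) (n : ℕ) : wordTail A w v n ≤ wordTail A w v' n := by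
  unfold wordTail
  refine sum_le_sum_of_subset_of_nonneg (fun f hf => ?_) fun f hf _ => ?_
  · rw [mem_filter] at hf ⊢
    exact ⟨hf.1, hf.2.trans (sum_le_sum fun j _ => hv _ (Fintype.mem_piFinset.1 hf.1 j))⟩
  · exact prod_nonneg fun j _ => hw _ (Fintype.mem_piFinset.1 (mem_filter.1 hf).1 j)

theorem wordTail_eq_zero {ι : Type*} (A : Finset ι) (w v : ι → ℝ) (hv : ∀ i ∈ A, v i < 0) {n : ℕ}
    (hn : n ≠ 0) : wordTail A w v n = 0 := by
  unfold wordTail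
  rw [filter_eq_empty_iff.2, sum_empty]
  intro f hf
  have : NeZero n := ⟨hn⟩
  exact not_le.2 (sum_neg (fun j _ => hv _ (Fintype.mem_piFinset.1 hf j)) ⟨0, mem_univ _⟩)

theorem wordTail_eq_pow {ι : Type*} (A : Finset ι) (w v : ι → ℝ) (hv : ∀ i ∈ A, 0 ≤ v i)
    (n : ℕ) : wordTail A w v n = (∑ i ∈ A, w i) ^ n := by
  rw [← sum_piFinset_prod]
  unfold wordTail
  rw [filter_true_of_mem]
  exact fun f hf => sum_nonneg fun j _ => hv _ (Fintype.mem_piFinset.1 hf j)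

/-! ### Exponential tilting and the Cramér-type comparison. -/

/-- A lower bound by exponential tilting: if `w i` is `y i` times the exponential of a nonnegative
multiple of `u i`, then the words for which the sum of the `u` is nonpositive have smaller tilted
weight. -/
theorem le_wordTail_of_tilt {ι : Type*} (B : Finset ι) (y v u : ι → ℝ) (hy : ∀ i ∈ B, 0 ≤ y i)
    {c : ℝ} (hc : 0 ≤ c) (n : ℕ) :
    (∑ i ∈ B, y i * Real.exp (c * u i)) ^ n
      - wordTail B (fun i => y i * Real.exp (c * u i)) (fun i => -v i) n
      - wordTail B (fun i => y i * Real.exp (c * u i)) u n ≤ wordTail B y v n := by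
  rw [← sum_piFinset_prod]
  unfold wordTail
  have h1 : ∀ f ∈ Fintype.piFinset (fun _ : Fin n => B), 0 ≤ ∏ j, y (f j) := fun f hf =>
    prod_nonneg fun j _ => hy _ (Fintype.mem_piFinset.1 hf j)
  have h2 : ∀ f : Fin n → ι, ∏ j, (y (f j) * Real.exp (c * u (f j))) =
      (∏ j, y (f j)) * Real.exp (c * ∑ j, u (f j)) := fun f => by
    rw [prod_mul_distrib, ← Real.exp_sum, mul_sum]
  simp only [sum_filter, h2]
  rw [← sum_sub_distrib, ← sum_sub_distrib]
  refine sum_le_sum fun f hf => ?_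
  have h3 := h1 f hf
  have h4 := mul_nonneg h3 (Real.exp_pos (c * ∑ j, u (f j))).le
  rw [sum_neg_distrib]
  split_ifs with ha hb hd hd hb hd hd
  all_goals try linarith
  -- The remaining words have a nonnegative sum of `v` and a negative sum of `u`: they are counted
  -- on the right, and tilting only lowers their weight.
  have : Real.exp (c * ∑ j, u (f j)) ≤ 1 :=
    Real.exp_le_one_iff.2 (mul_nonpos_of_nonneg_of_nonpos hc (by linarith))
  nlinarith

/-- Let `p → ∞` along the integers: a ratio `x i / y k > 1` would have powers bounded by the
cardinality of `B`. -/
theorem le_max_of_powerSum_le {ι κ : Type*} (A : Finset ι) (B : Finset κ) (x : ι → ℝ) (y : κ → ℝ)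
    (hx : ∀ i ∈ A, 0 < x i) (hy : ∀ i ∈ B, 0 < y i)
    (h : ∀ p : ℝ, 1 ≤ p → ∑ i ∈ A, x i ^ p ≤ ∑ i ∈ B, y i ^ p)
    {k : κ} (hk : k ∈ B) (hmax : ∀ i ∈ B, y i ≤ y k) : ∀ i ∈ A, x i ≤ y k := by
  intro i hi
  by_contra! hlt
  have hk0 := hy k hk
  obtain ⟨n, hn⟩ := pow_unbounded_of_one_lt (#B : ℝ) ((one_lt_div hk0).2 hlt)
  have h1 : 1 < x i / y k := (one_lt_div hk0).2 hlt
  have h2 : (x i / y k) ^ (n + 1) ≤ #B := by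
    rw [div_pow, div_le_iff₀ (by positivity)]
    have h3 := h (n + 1 : ℕ) (by push_cast; linarith [n.cast_nonneg (α := ℝ)])
    simp only [Real.rpow_natCast] at h3
    calc x i ^ (n + 1) ≤ ∑ i ∈ A, x i ^ (n + 1) :=
          single_le_sum (f := fun i => x i ^ (n + 1)) (fun j hj => (pow_pos (hx j hj) _).le) hi
      _ ≤ ∑ i ∈ B, y i ^ (n + 1) := h3
      _ ≤ #B • y k ^ (n + 1) := sum_le_card_nsmul _ _ _ fun j hj =>
          pow_le_pow_left₀ (hy j hj).le (hmax j hj) _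
      _ = _ := by rw [nsmul_eq_mul]
  exact absurd ((pow_le_pow_right₀ h1.le n.le_succ).trans h2) (not_le.2 hn)

/-- The tilting parameter: either the mean of `u` is positive already, or it vanishes after
tilting. -/
theorem exists_tilt_mean_eq_zero {ι : Type*} (B : Finset ι) (u : ι → ℝ)
    (h1 : ∑ i ∈ B, u i * Real.exp (1 * u i) ≤ 0) {k : ι} (hk : k ∈ B) (hu : 0 < u k) :
    ∃ p : ℝ, 1 ≤ p ∧ ∑ i ∈ B, u i * Real.exp (p * u i) = 0 := by
  set g : ℝ → ℝ := fun p => ∑ i ∈ B, u i * Real.exp (p * u i) with hg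
  have hcont : Continuous g := by fun_prop
  have hlow : ∀ p : ℝ, 0 ≤ p → ∀ z : ℝ, z ≤ z * Real.exp (p * z) := by
    intro p hp z
    rcases le_total 0 z with hz | hz
    · exact le_mul_of_one_le_right hz (Real.one_le_exp (mul_nonneg hp hz))
    · have := Real.exp_le_one_iff.2 (mul_nonpos_of_nonneg_of_nonpos hp hz)
      nlinarith
  have hlow' : ∀ p : ℝ, 0 ≤ p → (∑ i ∈ B, u i) + p * u k ^ 2 ≤ g p := by
    intro p hp
    classical
    rw [hg]
    simp only
    rw [← sum_erase_add _ _ hk, ← sum_erase_add _ _ hk, add_assoc]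
    refine add_le_add (sum_le_sum fun i _ => hlow p hp _) ?_
    have := Real.add_one_le_exp (p * u k)
    nlinarith
  -- The linear lower bound `hlow'` is nonnegative at this `P`, so `g` changes sign on `[1, P]`.
  set P : ℝ := 1 + |∑ i ∈ B, u i| / u k ^ 2 with hP
  have hP1 : 1 ≤ P := by have : 0 ≤ |∑ i ∈ B, u i| / u k ^ 2 := by positivity
                         linarith
  have hgP : 0 ≤ g P := by
    have h2 := hlow' P (by linarith)
    have h3 : P * u k ^ 2 = u k ^ 2 + |∑ i ∈ B, u i| := by rw [hP]; field_simp
    have h4 := neg_abs_le (∑ i ∈ B, u i)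
    nlinarith
  obtain ⟨p, hp, hp0⟩ := intermediate_value_Icc hP1 hcont.continuousOn ⟨h1, hgP⟩
  exact ⟨p, hp.1, hp0⟩

/-- Comparison of the large deviations of `log x` under `x` and `log y` under `y`. -/
theorem eventually_pow_mul_wordTail_le {ι κ : Type*} (A : Finset ι) (B : Finset κ) (x : ι → ℝ)
    (y : κ → ℝ) (hx : ∀ i ∈ A, 0 < x i) (hy : ∀ i ∈ B, 0 < y i) (hB : B.Nonempty)
    (h : ∀ p : ℝ, 1 ≤ p → ∑ i ∈ A, x i ^ p ≤ ∑ i ∈ B, y i ^ p)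
    {q t t' : ℝ} (hq0 : 0 < q) (hq1 : q < 1) (htt : t < t') :
    ∀ᶠ n : ℕ in Filter.atTop, q ^ n * wordTail A x (fun i => Real.log (x i) - t') n ≤
      wordTail B y (fun i => Real.log (y i) - t) n := by
  obtain ⟨k, hk, hmax⟩ := exists_max_image B y hB
  -- If `log y` never exceeds `t`, neither does `log x`, and the left side vanishes for `n ≠ 0`.
  rcases le_or_gt (Real.log (y k)) t with hkt | hkt
  · filter_upwards [Filter.eventually_ne_atTop 0] with n hn
    rw [wordTail_eq_zero A x _ _ hn, mul_zero]
    · exact wordTail_nonneg B y _ (fun i hi => (hy i hi).le) n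
    · intro i hi
      have := Real.log_le_log (hx i hi) (le_max_of_powerSum_le A B x y hx hy h hk hmax i hi)
      linarith
  -- `τ` is the target for the tilted mean of `log y`: above `t` and below `t'`, so that sums below
  -- `n t` or above `n t'` are both exponentially rare, and below the maximum, so that tilting can
  -- reach it.
  obtain ⟨τ, hτ, hτ'⟩ := exists_between (lt_min htt hkt)
  rw [lt_min_iff] at hτ'
  -- it is enough to find a good tilting exponent `c`
  suffices H : ∃ c : ℝ, 0 ≤ c ∧ ∃ r₁ r₂ : ℝ, 0 ≤ r₁ ∧ 0 ≤ r₂ ∧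
      r₁ < ∑ i ∈ B, y i * Real.exp (c * (Real.log (y i) - t')) ∧
      r₂ < ∑ i ∈ B, y i * Real.exp (c * (Real.log (y i) - t')) ∧
      ∀ n, (∑ i ∈ B, y i * Real.exp (c * (Real.log (y i) - t'))) ^ n - r₁ ^ n - r₂ ^ n ≤
        wordTail B y (fun i => Real.log (y i) - t) n by
    obtain ⟨c, hc, r₁, r₂, hr₁, hr₂, h₁, h₂, H⟩ := H
    set W := ∑ i ∈ B, y i * Real.exp (c * (Real.log (y i) - t')) with hW
    have hW0 : 0 < W := hr₁.trans_lt h₁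
    -- `W` is `exp (-c t')` times the power sum of `y` of exponent `1 + c`, so the hypothesis turns
    -- Chernoff's bound for `x` into `W ^ n`.
    have hxW : ∀ n, wordTail A x (fun i => Real.log (x i) - t') n ≤ W ^ n := by
      intro n
      refine (wordTail_le_exp A x _ (fun i hi => (hx i hi).le) n hc).trans
        (pow_le_pow_left₀ (sum_nonneg fun i hi => mul_nonneg (hx i hi).le (Real.exp_pos _).le)
          ?_ n)
      have key : ∀ z : ℝ, 0 < z → z * Real.exp (c * (Real.log z - t')) =
          Real.exp (-(c * t')) * z ^ (1 + c) := by
        intro z hz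
        rw [Real.rpow_def_of_pos hz, ← Real.exp_add]
        nth_rewrite 1 [← Real.exp_log hz]
        rw [← Real.exp_add]
        ring_nf
      rw [hW, sum_congr rfl fun i hi => key _ (hx i hi), sum_congr rfl fun i hi => key _ (hy i hi),
        ← mul_sum, ← mul_sum]
      exact mul_le_mul_of_nonneg_left (h _ (by linarith)) (Real.exp_pos _).le
    have hlim : Filter.Tendsto (fun n : ℕ => q ^ n + (r₁ / W) ^ n + (r₂ / W) ^ n)
        Filter.atTop (nhds 0) := by
      have a1 := tendsto_pow_atTop_nhds_zero_of_lt_one hq0.le hq1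
      have a2 := tendsto_pow_atTop_nhds_zero_of_lt_one (div_nonneg hr₁ hW0.le)
        ((div_lt_one hW0).2 h₁)
      have a3 := tendsto_pow_atTop_nhds_zero_of_lt_one (div_nonneg hr₂ hW0.le)
        ((div_lt_one hW0).2 h₂)
      simpa using (a1.add a2).add a3
    filter_upwards [hlim.eventually_lt_const one_pos] with n hn
    refine (mul_le_mul_of_nonneg_left (hxW n) (pow_pos hq0 n).le).trans (le_trans ?_ (H n))
    have hWn : 0 < W ^ n := pow_pos hW0 n
    have e1 : (r₁ / W) ^ n * W ^ n = r₁ ^ n := by rw [div_pow]; field_simp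
    have e2 : (r₂ / W) ^ n * W ^ n = r₂ ^ n := by rw [div_pow]; field_simp
    nlinarith
  have tilt : ∀ c p : ℝ, p = 1 + c → ∀ i ∈ B, y i * Real.exp (c * (Real.log (y i) - t')) =
      Real.exp (p * τ - c * t') * Real.exp (p * (Real.log (y i) - τ)) := by
    rintro c p rfl i hi
    nth_rewrite 1 [← Real.exp_log (hy i hi)]
    rw [← Real.exp_add, ← Real.exp_add]
    ring_nf
  -- Up to a positive factor, the sum at `p = 1` is the mean of `log y - τ` under `y` itself. If it
  -- is nonpositive, some exponent `p ≥ 1` moves the mean to `τ`; otherwise no tilting is needed and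
  -- `c = 0` works.
  by_cases hmean : ∑ i ∈ B, (Real.log (y i) - τ) * Real.exp (1 * (Real.log (y i) - τ)) ≤ 0
  · obtain ⟨p, hp, hp0⟩ := exists_tilt_mean_eq_zero B _ hmean hk (sub_pos.2 hτ'.2)
    set w : κ → ℝ := fun i => y i * Real.exp ((p - 1) * (Real.log (y i) - t')) with hw
    have hwpos : ∀ i ∈ B, 0 < w i := fun i hi => mul_pos (hy i hi) (Real.exp_pos _)
    have hW : 0 < ∑ i ∈ B, w i := sum_pos hwpos hB
    have hw0 : ∑ i ∈ B, w i * (Real.log (y i) - τ) = 0 := by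
      have : ∀ i ∈ B, w i * (Real.log (y i) - τ) = Real.exp (p * τ - (p - 1) * t') *
          ((Real.log (y i) - τ) * Real.exp (p * (Real.log (y i) - τ))) := fun i hi => by
        rw [hw]
        simp only
        rw [tilt (p - 1) p (by ring) i hi]
        ring
      rw [sum_congr rfl this, ← mul_sum, hp0, mul_zero]
    have hshift : ∀ s, ∑ i ∈ B, w i * (Real.log (y i) - s) = (τ - s) * ∑ i ∈ B, w i := by
      intro s
      rw [← zero_add ((τ - s) * _), ← hw0, mul_sum, ← sum_add_distrib]
      exact sum_congr rfl fun i _ => by ring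
    obtain ⟨r₁, hr₁, h₁, H₁⟩ := exists_wordTail_le_pow B w (fun i => -(Real.log (y i) - t))
      (fun i hi => (hwpos i hi).le) (by
        simp only [mul_neg, sum_neg_distrib, hshift]
        nlinarith)
    obtain ⟨r₂, hr₂, h₂, H₂⟩ := exists_wordTail_le_pow B w (fun i => Real.log (y i) - t')
      (fun i hi => (hwpos i hi).le) (by
        rw [hshift]
        nlinarith)
    refine ⟨p - 1, by linarith, r₁, r₂, hr₁, hr₂, h₁, h₂, fun n => ?_⟩
    have := le_wordTail_of_tilt B y (fun i => Real.log (y i) - t) (fun i => Real.log (y i) - t')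
      (fun i hi => (hy i hi).le) (sub_nonneg.2 hp) n
    have a1 := H₁ n
    have a2 := H₂ n
    linarith
  · have hmean' : 0 < ∑ i ∈ B, y i * (Real.log (y i) - τ) := by
      have : ∀ i ∈ B, (Real.log (y i) - τ) * Real.exp (1 * (Real.log (y i) - τ)) =
          Real.exp (-τ) * (y i * (Real.log (y i) - τ)) := fun i hi => by
        rw [one_mul, sub_eq_add_neg, Real.exp_add, Real.exp_log (hy i hi)]
        ring
      rw [sum_congr rfl this, ← mul_sum, not_le] at hmean
      exact pos_of_mul_pos_right hmean (Real.exp_pos _).le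
    have hneg : ∑ i ∈ B, y i * -(Real.log (y i) - t) < 0 := by
      have : ∑ i ∈ B, y i * (Real.log (y i) - τ) ≤ ∑ i ∈ B, y i * (Real.log (y i) - t) :=
        sum_le_sum fun i hi => mul_le_mul_of_nonneg_left (by linarith) (hy i hi).le
      simp only [mul_neg, sum_neg_distrib]
      linarith
    obtain ⟨r₁, hr₁, h₁, H₁⟩ := exists_wordTail_le_pow B y (fun i => -(Real.log (y i) - t))
      (fun i hi => (hy i hi).le) hneg
    refine ⟨0, le_rfl, r₁, 0, hr₁, le_rfl, by simpa using h₁, by simpa using sum_pos hy hB,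
      fun n => ?_⟩
    rcases eq_or_ne n 0 with rfl | hn
    · have := wordTail_nonneg B y (fun i => Real.log (y i) - t) (fun i hi => (hy i hi).le) 0
      simp only [pow_zero]
      linarith
    -- For `c = 0` the function `u` is free; the constant `-1` makes its tail vanish for `n ≠ 0`.
    have := le_wordTail_of_tilt B y (fun i => Real.log (y i) - t) (fun _ => -1)
      (fun i hi => (hy i hi).le) le_rfl n
    have z : wordTail B (fun i => y i * Real.exp (0 * -1)) (fun _ => -1) n = 0 :=
      wordTail_eq_zero B _ _ (by simp) hn
    rw [z] at this
    simp only [zero_mul, Real.exp_zero, mul_one, sub_zero, zero_pow hn] at this ⊢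
    have a1 := H₁ n
    linarith

/-! ### Tail sums and majorization. -/

/-- The sum of the components of `u` that are at least `s`. -/
noncomputable def tailSum {ι : Type*} (u : ι → ℝ) (s : ℝ) : ℝ :=
  ∑' i, if s ≤ u i then u i else 0

theorem tailSum_eq_of_isDecreasingRearrangement {ι : Type*} {u : ι → ℝ} {z : ℕ → ℝ}
    (h : IsDecreasingRearrangement u z) (s : ℝ) : tailSum z s = tailSum u s := by
  obtain ⟨e, he⟩ := h.perm
  have hs : ∀ {κ : Type _} (w : κ → ℝ),
      Function.support (fun i => if s ≤ w i then w i else 0) ⊆ Function.support w := by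
    intro κ w i hi hw
    simp [hw] at hi
  have hs' : Function.support (fun i => if s ≤ z i then z i else 0) ⊆ Function.support z := by
    intro i hi hw
    simp [hw] at hi
  unfold tailSum
  rw [← tsum_subtype_eq_of_support_subset (hs u), ← tsum_subtype_eq_of_support_subset hs',
    ← e.tsum_eq]
  simp only [he]

theorem exists_isDecreasingRearrangement {ι : Type*} {u : ι → ℝ} (hu : ∀ i, 0 ≤ u i)
    (hfin : (Function.support u).Finite) :
    ∃ z : ℕ → ℝ, IsDecreasingRearrangement u z ∧ (Function.support z).Finite ∧ ∀ i, 0 ≤ z i := by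
  have : Fintype (Function.support u) := hfin.fintype
  let e := Fintype.equivFin (Function.support u)
  set m := Fintype.card (Function.support u)
  let σ := Tuple.sort fun i => -u (e.symm i)
  have hσ : Antitone fun i => u (e.symm (σ i)) := fun i j hij =>
    neg_le_neg_iff.1 (Tuple.monotone_sort (fun i => -u (e.symm i)) hij)
  let z : ℕ → ℝ := fun i => if h : i < m then u (e.symm (σ ⟨i, h⟩)) else 0
  have hz0 : ∀ i, 0 ≤ z i := fun i => by
    simp only [z]
    split_ifs
    exacts [hu _, le_rfl]
  have hsupp : ∀ i, z i ≠ 0 ↔ i < m := fun i => by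
    simp only [z]
    split_ifs with h
    · exact iff_of_true (e.symm (σ ⟨i, h⟩)).2 h
    · simp [h]
  refine ⟨z, ⟨fun i j hij => ?_, ?_⟩, (Set.finite_lt_nat m).subset fun i hi => (hsupp i).1 hi, hz0⟩
  · by_cases hj : j < m
    · have hi : i < m := hij.trans_lt hj
      simp only [z, hi, hj, dif_pos]
      exact hσ (Fin.mk_le_mk.2 hij)
    · have : z j = 0 := by simp [z, hj]
      rw [this]
      exact hz0 i
  · let e' : Function.support z ≃ Fin m :=
      { toFun := fun i => ⟨i, (hsupp i).1 i.2⟩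
        invFun := fun i => ⟨i, (hsupp i).2 i.2⟩
        left_inv := fun _ => rfl
        right_inv := fun _ => rfl }
    refine ⟨e.trans (σ.symm.trans e'.symm), fun i => ?_⟩
    have : ∀ k : Fin m, z (e'.symm k) = u (e.symm (σ k)) := fun k => by
      change z (k : ℕ) = _
      simp [z]
    simp [this]

/-- Majorization follows from the comparison of the tail sums. -/
theorem majorized_of_tailSum_le {ι κ : Type*} {u : ι → ℝ} {v : κ → ℝ} (hu : ∀ i, 0 ≤ u i)
    (hv : ∀ i, 0 ≤ v i) (hu' : (Function.support u).Finite) (hv' : (Function.support v).Finite)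
    (h : ∀ s, 0 < s → tailSum u s ≤ tailSum v s) : Majorized u v := by
  obtain ⟨a, ha, hafin, ha0⟩ := exists_isDecreasingRearrangement hu hu'
  obtain ⟨b, hb, hbfin, hb0⟩ := exists_isDecreasingRearrangement hv hv'
  refine ⟨a, b, ha, hb, fun k => ?_⟩
  induction k with
  | zero => simp
  | succ k ih =>
    rcases le_or_gt (a k) (b k) with hk | hk
    · rw [sum_range_succ, sum_range_succ]
      exact add_le_add ih hk
    -- Use the threshold `a k`: it admits all of `a 0, …, a k`, but only terms of `b` of index less
    -- than `k`, since `b k < a k`.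
    have hpos : 0 < a k := (hb0 k).trans_lt hk
    have h1 : ∑ i ∈ range (k + 1), a i ≤ tailSum a (a k) := by
      have hsum : Summable fun i => if a k ≤ a i then a i else 0 :=
        summable_of_hasFiniteSupport (hafin.subset fun i hi h0 => by simp [h0] at hi)
      refine le_trans (le_of_eq ?_) (hsum.sum_le_tsum (range (k + 1)) fun i _ => ?_)
      · refine sum_congr rfl fun i hi => ?_
        rw [if_pos (ha.antitone (Nat.lt_succ_iff.1 (mem_range.1 hi)))]
      · split_ifs
        exacts [ha0 i, le_rfl]
    have h2 : tailSum b (a k) ≤ ∑ i ∈ range (k + 1), b i := by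
      unfold tailSum
      rw [tsum_eq_sum (s := range (k + 1))]
      · refine sum_le_sum fun i _ => ?_
        split_ifs
        exacts [le_rfl, hb0 i]
      · intro i hi
        have : b i ≤ b k := hb.antitone (by simp at hi; omega)
        rw [if_neg (by linarith)]
    rw [tailSum_eq_of_isDecreasingRearrangement ha] at h1
    rw [tailSum_eq_of_isDecreasingRearrangement hb] at h2
    exact h1.trans ((h _ hpos).trans h2)

/-! ### The `ℓ₁` estimate and tail sums of tensor powers. -/

theorem l1Dist_le_of_common_part {ι : Type*} {x z w : ι → ℝ} (hx : IsProbVec x)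
    (hz : IsProbVec z) (hwx : ∀ i, w i ≤ x i) (hwz : ∀ i, w i ≤ z i) {c : ℝ} (hw : HasSum w c) :
    l1Dist x z ≤ 2 * (1 - c) := by
  have hs : HasSum (fun i => (x i - w i) + (z i - w i)) (2 * (1 - c)) := by
    rw [two_mul]
    exact (hx.hasSum_one.sub hw).add (hz.hasSum_one.sub hw)
  have hle : ∀ i, |x i - z i| ≤ (x i - w i) + (z i - w i) := fun i => by
    have := hwx i
    have := hwz i
    rw [abs_le]
    constructor <;> linarith
  unfold l1Dist
  rw [← hs.tsum_eq]
  exact (Summable.of_nonneg_of_le (fun _ => abs_nonneg _) hle hs.summable).tsum_le_tsum hle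
    hs.summable

/-- Tail sums of tensor powers in terms of words. -/
theorem tailSum_tensorPow {ι : Type*} (A : Finset ι) (x : ι → ℝ) (hA : ∀ i ∈ A, 0 < x i)
    (hA' : ∀ i ∉ A, x i = 0) (n : ℕ) (t : ℝ) :
    tailSum (tensorPow n x) (Real.exp (n * t)) =
      wordTail A x (fun i => Real.log (x i) - t) n := by
  classical
  unfold tailSum wordTail
  rw [tsum_eq_sum (s := Fintype.piFinset fun _ : Fin n => A), ← sum_filter]
  · refine sum_congr (filter_congr fun f hf => ?_) fun f _ => rfl
    rw [Fintype.mem_piFinset] at hf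
    have h0 : 0 < tensorPow n x f := prod_pos fun j _ => hA _ (hf j)
    rw [← Real.le_log_iff_exp_le h0, tensorPow, Real.log_prod fun j _ => (hA _ (hf j)).ne',
      sum_sub_distrib, sum_const, card_univ, Fintype.card_fin, nsmul_eq_mul, sub_nonneg]
  · intro f hf
    rw [Fintype.mem_piFinset, not_forall] at hf
    obtain ⟨j, hj⟩ := hf
    have : tensorPow n x f = 0 := prod_eq_zero (mem_univ j) (hA' _ hj)
    simp [this]

theorem tensorPow_nonneg {ι : Type*} {x : ι → ℝ} (hx : ∀ i, 0 ≤ x i) (n : ℕ) (f : Fin n → ι) :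
    0 ≤ tensorPow n x f := prod_nonneg fun j _ => hx (f j)

theorem tensorPow_eq_zero_of_notMem {ι : Type*} {A : Finset ι} {x : ι → ℝ}
    (hA : ∀ i ∉ A, x i = 0) {n : ℕ} {f : Fin n → ι}
    (hf : f ∉ Fintype.piFinset fun _ : Fin n => A) : tensorPow n x f = 0 := by
  rw [Fintype.mem_piFinset, not_forall] at hf
  obtain ⟨j, hj⟩ := hf
  exact prod_eq_zero (mem_univ j) (hA _ hj)

theorem finite_support_tensorPow {ι : Type*} {x : ι → ℝ} (hx : (Function.support x).Finite)
    (n : ℕ) : (Function.support (tensorPow n x)).Finite := by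
  refine (Fintype.piFinset fun _ : Fin n => hx.toFinset).finite_toSet.subset fun f hf => ?_
  by_contra hf'
  exact hf (tensorPow_eq_zero_of_notMem (A := hx.toFinset) (fun i hi => by simpa using hi) hf')

/-! ### Power sums under lumping. -/

/-- Lumping the terms of a series from `K` on into the first term increases the power sums. -/
theorem powerSum_le_ofReal_sum_lump {y z : ℕ → ℝ} (hy : IsProbVec y) {K : ℕ} (hK : 0 < K)
    (hz0 : z 0 = y 0 + (1 - ∑ i ∈ range K, y i)) (hz : ∀ i, 0 < i → i < K → z i = y i)
    {p : ℝ} (hp : 1 ≤ p) : powerSum p y ≤ ENNReal.ofReal (∑ i ∈ range K, z i ^ p) := by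
  have hle1 : ∀ F : Finset ℕ, ∑ i ∈ F, y i ≤ 1 := fun F =>
    sum_le_hasSum F (fun i _ => hy.nonneg i) hy.hasSum_one
  set r := 1 - ∑ i ∈ range K, y i with hr
  have hr0 : 0 ≤ r := sub_nonneg.2 (hle1 _)
  -- This yields superadditivity of the `p`-th power, used both to merge `r` into the first term and
  -- to bound the power sum of the tail by `r ^ p`.
  have hpow : ∀ a b : ℝ, 0 ≤ a → a ≤ b → a ^ p ≤ a * b ^ (p - 1) := by
    intro a b ha hab
    rcases ha.eq_or_lt with rfl | ha
    · simp [Real.zero_rpow (by linarith : p ≠ 0)]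
    · calc a ^ p = a * a ^ (p - 1) := by
            rw [Real.rpow_sub_one ha.ne']
            field_simp
        _ ≤ _ := mul_le_mul_of_nonneg_left
          (Real.rpow_le_rpow ha.le hab (by linarith)) ha.le
  have hmul : ∀ b : ℝ, 0 ≤ b → b * b ^ (p - 1) = b ^ p := by
    intro b hb
    rcases hb.eq_or_lt with rfl | hb
    · simp [Real.zero_rpow (by linarith : p ≠ 0)]
    · rw [Real.rpow_sub_one hb.ne']
      field_simp
  have hadd : y 0 ^ p + r ^ p ≤ z 0 ^ p := by
    have hy0 := hy.nonneg 0
    rw [← hmul (z 0) (by rw [hz0]; linarith)]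
    have h1 := hpow (y 0) (z 0) hy0 (by rw [hz0]; linarith)
    have h2 := hpow r (z 0) hr0 (by rw [hz0]; linarith)
    calc _ ≤ y 0 * z 0 ^ (p - 1) + r * z 0 ^ (p - 1) := add_le_add h1 h2
      _ = _ := by rw [← add_mul, ← hz0]
  have hhead : ∑ i ∈ range K, y i ^ p + r ^ p ≤ ∑ i ∈ range K, z i ^ p := by
    obtain ⟨L, rfl⟩ : ∃ L, K = L + 1 := ⟨K - 1, by omega⟩
    rw [sum_range_succ', sum_range_succ' (fun i => z i ^ p)]
    have : ∑ i ∈ range L, z (i + 1) ^ p = ∑ i ∈ range L, y (i + 1) ^ p :=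
      sum_congr rfl fun i hi => by rw [hz (i + 1) (by omega) (by simp at hi; omega)]
    rw [this]
    linarith
  have hfin : ∀ F : Finset ℕ, ∑ i ∈ F, y i ^ p ≤ ∑ i ∈ range K, z i ^ p := by
    intro F
    have hnn : ∀ i, 0 ≤ y i ^ p := fun i => Real.rpow_nonneg (hy.nonneg i) p
    have htail : ∑ i ∈ F \ range K, y i ≤ r := by
      have := hle1 (range K ∪ (F \ range K))
      rw [sum_union disjoint_sdiff] at this
      rw [hr]
      linarith
    have htail' : ∑ i ∈ F \ range K, y i ^ p ≤ r ^ p := by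
      calc ∑ i ∈ F \ range K, y i ^ p ≤ ∑ i ∈ F \ range K, y i * r ^ (p - 1) :=
            sum_le_sum fun i hi => hpow _ _ (hy.nonneg i)
              ((single_le_sum (fun j _ => hy.nonneg j) hi).trans htail)
        _ = (∑ i ∈ F \ range K, y i) * r ^ (p - 1) := by rw [sum_mul]
        _ ≤ r * r ^ (p - 1) := mul_le_mul_of_nonneg_right htail (Real.rpow_nonneg hr0 _)
        _ = r ^ p := hmul r hr0
    calc ∑ i ∈ F, y i ^ p ≤ ∑ i ∈ range K ∪ (F \ range K), y i ^ p :=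
          sum_le_sum_of_subset_of_nonneg (fun i hi => by simp [hi]) fun i _ _ => hnn i
      _ = ∑ i ∈ range K, y i ^ p + ∑ i ∈ F \ range K, y i ^ p := sum_union disjoint_sdiff
      _ ≤ _ := by linarith
  unfold powerSum
  rw [ENNReal.tsum_eq_iSup_sum]
  refine iSup_le fun F => ?_
  refine le_trans ?_ (ENNReal.ofReal_le_ofReal (hfin F))
  rw [ENNReal.ofReal_sum_of_nonneg fun i _ => Real.rpow_nonneg (hy.nonneg i) p]
  refine sum_le_sum fun i _ => ?_
  split_ifs
  exacts [le_rfl, zero_le]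

/-! ### Uniformity in the threshold, small letters and scaling. -/

/-- Tails are monotone in the threshold, so half of `δ` pays for rounding `t` up to a grid of mesh
`δ / 2` and the other half for the pointwise comparison. A finite grid suffices: below the least
`log y` the right side is 1, and for `t > 0` the left side is 0. -/
theorem exists_forall_wordTail_le {ι κ : Type*} (A : Finset ι) (B : Finset κ) (x : ι → ℝ)
    (y : κ → ℝ) (hx : ∀ i ∈ A, 0 < x i) (hy : ∀ i ∈ B, 0 < y i) (hB : B.Nonempty)
    (h : ∀ p : ℝ, 1 ≤ p → ∑ i ∈ A, x i ^ p ≤ ∑ i ∈ B, y i ^ p)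
    (hxA : ∑ i ∈ A, x i ≤ 1) (hyB : ∑ i ∈ B, y i = 1)
    {q δ : ℝ} (hq0 : 0 < q) (hq1 : q < 1) (hδ : 0 < δ) :
    ∃ n : ℕ, n ≠ 0 ∧ ∀ t : ℝ, q ^ n * wordTail A x (fun i => Real.log (x i) - (t + δ)) n ≤
      wordTail B y (fun i => Real.log (y i) - t) n := by
  obtain ⟨k, hk, hmin⟩ := exists_min_image B y hB
  set t₀ := Real.log (y k) with ht₀
  obtain ⟨J, hJ⟩ := exists_nat_gt (-t₀ / (δ / 2))
  rw [div_lt_iff₀ (by positivity)] at hJ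
  have hev : ∀ᶠ n : ℕ in Filter.atTop, ∀ i ∈ range (J + 1),
      q ^ n * wordTail A x (fun j => Real.log (x j) - (t₀ + i * (δ / 2) + δ / 2)) n ≤
        wordTail B y (fun j => Real.log (y j) - (t₀ + i * (δ / 2))) n := by
    rw [Filter.eventually_all_finset]
    exact fun i _ => eventually_pow_mul_wordTail_le A B x y hx hy hB h hq0 hq1 (by linarith)
  obtain ⟨n, hn, hn0⟩ := (hev.and (Filter.eventually_ne_atTop 0)).exists
  refine ⟨n, hn0, fun t => ?_⟩
  have hx' : ∀ i ∈ A, 0 ≤ x i := fun i hi => (hx i hi).le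
  have hy' : ∀ i ∈ B, 0 ≤ y i := fun i hi => (hy i hi).le
  rcases le_or_gt t t₀ with ht | ht
  · rw [wordTail_eq_pow B y _ fun i hi => sub_nonneg.2
      (ht.trans (Real.log_le_log (hy k hk) (hmin i hi))), hyB, one_pow]
    refine mul_le_one₀ (pow_le_one₀ hq0.le hq1.le) (wordTail_nonneg _ _ _ hx' n) ?_
    exact (wordTail_le_pow _ _ _ hx' n).trans (pow_le_one₀ (sum_nonneg hx') hxA)
  rcases lt_or_ge 0 t with ht' | ht'
  · rw [wordTail_eq_zero A x _ _ hn0, mul_zero]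
    · exact wordTail_nonneg _ _ _ hy' n
    · intro i hi
      have := Real.log_nonpos (hx' i hi) ((single_le_sum hx' hi).trans hxA)
      linarith
  have hpos : 0 ≤ (t - t₀) / (δ / 2) := div_nonneg (sub_nonneg.2 ht.le) (by positivity)
  set i := ⌈(t - t₀) / (δ / 2)⌉₊ with hi
  have h1 : t - t₀ ≤ i * (δ / 2) := by
    rw [← div_le_iff₀ (by positivity)]
    exact Nat.le_ceil _
  have h2 : i * (δ / 2) ≤ t - t₀ + δ / 2 := by
    have := (Nat.ceil_lt_add_one hpos).le
    calc (i : ℝ) * (δ / 2) ≤ ((t - t₀) / (δ / 2) + 1) * (δ / 2) :=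
          mul_le_mul_of_nonneg_right this (by positivity)
      _ = _ := by field_simp
  have h3 : i ∈ range (J + 1) := by
    rw [mem_range, Nat.lt_succ_iff, hi, Nat.ceil_le, div_le_iff₀ (by positivity)]
    linarith
  refine le_trans (mul_le_mul_of_nonneg_left (wordTail_mono A x _ _ hx' (fun j _ => ?_) n)
    (pow_nonneg hq0.le n)) ((hn i h3).trans (wordTail_mono B y _ _ hy' (fun j _ => ?_) n))
  · linarith
  · linarith

/-- Letters of very small weight do not contribute to the tail. -/
theorem wordTail_le_of_subset {ι : Type*} (A' A : Finset ι) (z : ι → ℝ) (hA : A ⊆ A') {n : ℕ}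
    {t : ℝ} (hz : ∀ i ∈ A', 0 < z i ∧ z i ≤ 1) (hsmall : ∀ i ∈ A', i ∉ A → Real.log (z i) < n * t) :
    wordTail A' z (fun i => Real.log (z i) - t) n ≤ wordTail A z (fun i => Real.log (z i) - t) n := by
  have hlog : ∀ i ∈ A', Real.log (z i) ≤ 0 := fun i hi =>
    Real.log_nonpos (hz i hi).1.le (hz i hi).2
  unfold wordTail
  refine sum_le_sum_of_subset_of_nonneg (fun f hf => ?_) fun f hf _ => ?_
  · rw [mem_filter, Fintype.mem_piFinset] at hf ⊢
    refine ⟨fun j => ?_, hf.2⟩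
    -- All logarithms are nonpositive, so a single letter with logarithm below `n t` already spoils
    -- the whole word.
    by_contra hj
    have h1 := hf.2
    rw [sum_sub_distrib, sum_const, card_univ, Fintype.card_fin, nsmul_eq_mul,
      ← add_sum_erase _ _ (mem_univ j)] at h1
    have h2 : ∑ k ∈ univ.erase j, Real.log (z (f k)) ≤ 0 := sum_nonpos fun k _ => hlog _ (hf.1 k)
    have h3 := hsmall _ (hf.1 j) hj
    linarith
  · rw [mem_filter, Fintype.mem_piFinset] at hf
    exact prod_nonneg fun j _ => (hz _ (hA (hf.1 j))).1.le

/-- Each letter contributes one factor `q` to the weight and one summand `log q` to the value. -/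
theorem wordTail_scale {ι : Type*} (A : Finset ι) (x z : ι → ℝ) {q : ℝ} (hq : 0 < q)
    (hx : ∀ i ∈ A, 0 < x i) (hz : ∀ i ∈ A, z i = q * x i) (n : ℕ) (t : ℝ) :
    wordTail A z (fun i => Real.log (z i) - t) n =
      q ^ n * wordTail A x (fun i => Real.log (x i) - (t + -Real.log q)) n := by
  unfold wordTail
  rw [mul_sum]
  refine sum_congr (filter_congr fun f hf => ?_) fun f hf => ?_
  · rw [Fintype.mem_piFinset] at hf
    have : ∀ j, Real.log (z (f j)) - t = Real.log (x (f j)) - (t + -Real.log q) := fun j => by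
      rw [hz _ (hf j), Real.log_mul hq.ne' (hx _ (hf j)).ne']
      ring
    simp only [this]
  · rw [mem_filter, Fintype.mem_piFinset] at hf
    simp [hz _ (hf.1 _), prod_mul_distrib]

theorem IsProbVec.le_one {ι : Type*} {x : ι → ℝ} (hx : IsProbVec x) (i : ι) : x i ≤ 1 :=
  le_hasSum hx.hasSum_one i fun j _ => hx.nonneg j

/-! ### The finitely supported approximations. -/

/-- Cut `x` at `K`, scale it by `q`, and spread the remaining mass over `N` components. -/
noncomputable def spread (q : ℝ) (K N : ℕ) (x : ℕ → ℝ) (i : ℕ) : ℝ :=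
  if i < K then q * x i else if i < K + N then (1 - q * ∑ j ∈ range K, x j) / N else 0

/-- Cut `y` at `K` and add the remaining mass to the component at `0`. -/
noncomputable def lump (K : ℕ) (y : ℕ → ℝ) (i : ℕ) : ℝ :=
  if i < K then y i + (if i = 0 then 1 - ∑ j ∈ range K, y j else 0) else 0

theorem isProbVec_spread {x : ℕ → ℝ} (hx : IsProbVec x) {q : ℝ} (hq0 : 0 ≤ q) (hq1 : q ≤ 1)
    (K : ℕ) {N : ℕ} (hN : N ≠ 0) : IsProbVec (spread q K N x) := by
  have hle : ∑ i ∈ range K, x i ≤ 1 := sum_le_hasSum _ (fun i _ => hx.nonneg i) hx.hasSum_one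
  have hge : 0 ≤ ∑ i ∈ range K, x i := sum_nonneg fun i _ => hx.nonneg i
  refine ⟨fun i => ?_, ?_⟩
  · unfold spread
    split_ifs
    · exact mul_nonneg hq0 (hx.nonneg i)
    · exact div_nonneg (by nlinarith) (Nat.cast_nonneg N)
    · exact le_rfl
  · have hsum : ∑ i ∈ range (K + N), spread q K N x i = 1 := by
      have hN' : (N : ℝ) ≠ 0 := Nat.cast_ne_zero.2 hN
      have h1 : ∑ i ∈ range K, spread q K N x i = q * ∑ i ∈ range K, x i := by
        rw [mul_sum]
        exact sum_congr rfl fun i hi => by simp [spread, mem_range.1 hi]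
      have h2 : ∀ i ∈ range N, spread q K N x (K + i) = (1 - q * ∑ j ∈ range K, x j) / N :=
        fun i hi => by simp [spread, mem_range.1 hi]
      rw [sum_range_add, h1, sum_congr rfl h2, sum_const, card_range, nsmul_eq_mul]
      field_simp
      ring
    rw [← hsum]
    refine hasSum_sum_of_ne_finset_zero fun i hi => ?_
    rw [mem_range] at hi
    simp [spread, hi, show ¬i < K by omega]

theorem isProbVec_lump {y : ℕ → ℝ} (hy : IsProbVec y) {K : ℕ} (hK : 0 < K) :
    IsProbVec (lump K y) := by
  have hle : ∑ i ∈ range K, y i ≤ 1 := sum_le_hasSum _ (fun i _ => hy.nonneg i) hy.hasSum_one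
  refine ⟨fun i => ?_, ?_⟩
  · have := hy.nonneg i
    unfold lump
    split_ifs <;> linarith
  · have hsum : ∑ i ∈ range K, lump K y i = 1 := by
      rw [sum_congr rfl fun i hi => show lump K y i =
        y i + (if i = 0 then 1 - ∑ j ∈ range K, y j else 0) by simp [lump, mem_range.1 hi],
        sum_add_distrib, sum_ite_eq' , if_pos (mem_range.2 hK)]
      ring
    rw [← hsum]
    exact hasSum_sum_of_ne_finset_zero fun i hi => by simp [lump, mem_range.not.1 hi]

theorem l1Dist_spread_le {x : ℕ → ℝ} (hx : IsProbVec x) {q : ℝ} (hq0 : 0 ≤ q) (hq1 : q ≤ 1)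
    (K : ℕ) {N : ℕ} (hN : N ≠ 0) :
    l1Dist x (spread q K N x) ≤ 2 * (1 - q * ∑ i ∈ range K, x i) := by
  have hz := isProbVec_spread hx hq0 hq1 K hN
  refine l1Dist_le_of_common_part (w := fun i => if i < K then q * x i else 0) hx hz
    (fun i => ?_) (fun i => ?_) ?_
  · have := hx.nonneg i
    split_ifs
    · nlinarith
    · exact this
  · have := hz.nonneg i
    split_ifs with h
    · simp [spread, h]
    · exact this
  · rw [mul_sum, sum_congr rfl fun i hi => show q * x i = if i < K then q * x i else 0 by
      simp [mem_range.1 hi]]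
    exact hasSum_sum_of_ne_finset_zero fun i hi => by simp [mem_range.not.1 hi]

theorem l1Dist_lump_le {y : ℕ → ℝ} (hy : IsProbVec y) {K : ℕ} (hK : 0 < K) :
    l1Dist y (lump K y) ≤ 2 * (1 - ∑ i ∈ range K, y i) := by
  have hle : ∑ i ∈ range K, y i ≤ 1 := sum_le_hasSum _ (fun i _ => hy.nonneg i) hy.hasSum_one
  refine l1Dist_le_of_common_part (w := fun i => if i < K then y i else 0) hy
    (isProbVec_lump hy hK) (fun i => ?_) (fun i => ?_) ?_
  · have := hy.nonneg i
    split_ifs <;> linarith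
  · unfold lump
    split_ifs <;> linarith
  · rw [sum_congr rfl fun i hi => show y i = if i < K then y i else 0 by
      simp [mem_range.1 hi]]
    exact hasSum_sum_of_ne_finset_zero fun i hi => by simp [mem_range.not.1 hi]

/-! ### Choice of parameters and conclusion. -/

theorem mainTheorem5 (x y : ℕ → ℝ) (hx : IsProbVec x) (hy : IsProbVec y)
    (hN : ∀ p : ℝ, 1 ≤ p → powerSum p x ≤ powerSum p y)
    (hH : shannonEntropy x < ⊤) (ε : ℝ) (hε : 0 < ε) :
    ∃ xε yε : ℕ → ℝ,
      IsProbVec xε ∧ (Function.support xε).Finite ∧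
      IsProbVec yε ∧ (Function.support yε).Finite ∧
      l1Dist x xε ≤ ε ∧ l1Dist y yε ≤ ε ∧
      ∃ n : ℕ, 1 ≤ n ∧ Majorized (tensorPow n xε) (tensorPow n yε) := by
  -- The larger of the two distance bounds will be `2 (1 - (1 - η)²) ≤ 4 η`.
  obtain ⟨η, hη, hηε⟩ : ∃ η : ℝ, 0 < η ∧ η < min 1 (ε / 4) := exists_between (by positivity)
  rw [lt_min_iff] at hηε
  have hq0 : 0 < 1 - η := by linarith
  have hq1 : 1 - η < 1 := by linarith
  obtain ⟨K, ⟨hKx, hKy⟩, hK⟩ : ∃ K : ℕ,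
      (1 - η < ∑ i ∈ range K, x i ∧ 1 - η < ∑ i ∈ range K, y i) ∧ 0 < K :=
    (((hx.hasSum_one.tendsto_sum_nat.eventually_const_lt hq1).and
      (hy.hasSum_one.tendsto_sum_nat.eventually_const_lt hq1)).and
      (Filter.eventually_gt_atTop 0)).exists
  set z := lump K y with hz_def
  have hz : IsProbVec z := isProbVec_lump hy hK
  have hzK : ∀ i, K ≤ i → z i = 0 := fun i hi => by simp [z, lump, not_lt.2 hi]
  set A := (range K).filter (fun i => 0 < x i) with hA
  set B := (range K).filter (fun i => 0 < z i) with hB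
  have hAx : ∀ i ∈ A, 0 < x i := fun i hi => (mem_filter.1 hi).2
  have hBz : ∀ i ∈ B, 0 < z i := fun i hi => (mem_filter.1 hi).2
  have hB0 : ∀ i ∉ B, z i = 0 := fun i hi => by
    rcases lt_or_ge i K with h | h
    · refine le_antisymm (not_lt.1 fun h0 => hi ?_) (hz.nonneg i)
      exact mem_filter.2 ⟨mem_range.2 h, h0⟩
    · exact hzK i h
  have hBsum : ∑ i ∈ B, z i = 1 := (hasSum_sum_of_ne_finset_zero hB0).unique hz.hasSum_one
  have hBne : B.Nonempty := nonempty_of_ne_empty fun h => by simp [h] at hBsum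
  have hAsum : ∑ i ∈ A, x i ≤ 1 := sum_le_hasSum _ (fun i _ => hx.nonneg i) hx.hasSum_one
  have hpow : ∀ p : ℝ, 1 ≤ p → ∑ i ∈ A, x i ^ p ≤ ∑ i ∈ B, z i ^ p := by
    intro p hp
    have h1 : ENNReal.ofReal (∑ i ∈ A, x i ^ p) ≤ powerSum p x := by
      rw [ENNReal.ofReal_sum_of_nonneg fun i hi => Real.rpow_nonneg (hx.nonneg i) p]
      unfold powerSum
      refine le_trans (sum_le_sum fun i hi => ?_) (ENNReal.sum_le_tsum A)
      rw [if_pos (hAx i hi)]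
    have h2 := powerSum_le_ofReal_sum_lump (z := z) hy hK (by simp [z, lump, hK])
      (fun i hi hi' => by simp [z, lump, hi.ne', hi']) hp
    have h3 := (h1.trans (hN p hp)).trans h2
    rw [ENNReal.ofReal_le_ofReal_iff
      (sum_nonneg fun i _ => Real.rpow_nonneg (hz.nonneg i) p)] at h3
    refine h3.trans (le_of_eq (sum_subset (filter_subset _ _) fun i _ hi => ?_).symm)
    rw [hB0 i hi, Real.zero_rpow (by linarith)]
  -- The shift `δ = -log (1 - η)` is exactly the one produced by scaling with `1 - η`.
  obtain ⟨n, hn0, hn⟩ := exists_forall_wordTail_le A B x z hAx hBz hBne hpow hAsum hBsum hq0 hq1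
    (neg_pos.2 (Real.log_neg hq0 hq1))
  obtain ⟨k, hk, hmin⟩ := exists_min_image B z hBne
  -- `N` is chosen after `n`, so that `1 / N < z k ^ n`, the least positive component of the tensor
  -- power of `z`.
  obtain ⟨N, hNn⟩ := exists_nat_gt (Real.exp (-(n * Real.log (z k))))
  have hN0 : (0 : ℝ) < N := (Real.exp_pos _).trans hNn
  have hN0' : N ≠ 0 := Nat.cast_ne_zero.1 hN0.ne'
  set w := spread (1 - η) K N x with hw_def
  have hw : IsProbVec w := isProbVec_spread hx hq0.le hq1.le K hN0'
  set A' := (range (K + N)).filter (fun i => 0 < w i) with hA'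
  have hA'w : ∀ i ∈ A', 0 < w i := fun i hi => (mem_filter.1 hi).2
  have hwA : ∀ i, i < K → w i = (1 - η) * x i := fun i hi => by simp [w, spread, hi]
  have hA'0 : ∀ i ∉ A', w i = 0 := fun i hi => by
    rcases lt_or_ge i (K + N) with h | h
    · refine le_antisymm (not_lt.1 fun h0 => hi ?_) (hw.nonneg i)
      exact mem_filter.2 ⟨mem_range.2 h, h0⟩
    · simp [w, spread, not_lt.2 h, show ¬i < K by omega]
  have hA'sum : ∑ i ∈ A', w i = 1 := (hasSum_sum_of_ne_finset_zero hA'0).unique hw.hasSum_one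
  have hAA' : A ⊆ A' := fun i hi => by
    have hiK := mem_range.1 (mem_filter.1 hi).1
    refine mem_filter.2 ⟨mem_range.2 (by omega), ?_⟩
    rw [hwA i hiK]
    exact mul_pos hq0 (hAx i hi)
  have hfin : ∀ {u : ℕ → ℝ} {C : Finset ℕ}, (∀ i ∉ C, u i = 0) → (Function.support u).Finite :=
    fun {u C} hu => C.finite_toSet.subset fun i hi => by
      by_contra h
      exact hi (hu i h)
  refine ⟨w, z, hw, hfin hA'0, hz, hfin hB0, ?_, ?_, n, Nat.one_le_iff_ne_zero.2 hn0, ?_⟩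
  · refine (l1Dist_spread_le hx hq0.le hq1.le K hN0').trans ?_
    nlinarith
  · refine (l1Dist_lump_le hy hK).trans ?_
    linarith
  refine majorized_of_tailSum_le (tensorPow_nonneg hw.nonneg n) (tensorPow_nonneg hz.nonneg n)
    (finite_support_tensorPow (hfin hA'0) n) (finite_support_tensorPow (hfin hB0) n)
    fun s hs => ?_
  obtain ⟨t, rfl⟩ : ∃ t : ℝ, s = Real.exp (n * t) :=
    ⟨Real.log s / n, by rw [mul_div_cancel₀ _ (Nat.cast_ne_zero.2 hn0), Real.exp_log hs]⟩
  rw [tailSum_tensorPow A' w hA'w hA'0, tailSum_tensorPow B z hBz hB0]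
  -- At or below `log (z k)` every word in `B` counts and the right side is 1; above it the spread
  -- letters drop out.
  rcases le_or_gt t (Real.log (z k)) with ht | ht
  · rw [wordTail_eq_pow B z _ fun i hi => sub_nonneg.2
      (ht.trans (Real.log_le_log (hBz k hk) (hmin i hi))), hBsum, ← hA'sum]
    exact wordTail_le_pow _ _ _ (fun i hi => (hA'w i hi).le) n
  · refine (wordTail_le_of_subset A' A w hAA' (fun i hi => ⟨hA'w i hi, hw.le_one i⟩)
      fun i hi hiA => ?_).trans ?_
    · have hiK : ¬i < K := fun h => hiA <| mem_filter.2 ⟨mem_range.2 h, by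
        have := hA'w i hi
        rw [hwA i h] at this
        exact pos_of_mul_pos_right this hq0.le⟩
      have hiN : i < K + N := mem_range.1 (mem_filter.1 hi).1
      have hwi : w i ≤ 1 / N := by
        simp only [w, spread, hiK, hiN, if_false, if_true]
        refine div_le_div_of_nonneg_right ?_ hN0.le
        nlinarith
      calc Real.log (w i) ≤ Real.log (1 / N) := Real.log_le_log (hA'w i hi) hwi
        _ = -Real.log N := by rw [one_div, Real.log_inv]
        _ < n * Real.log (z k) := by
          rw [neg_lt]
          exact (Real.lt_log_iff_exp_lt hN0).2 hNn
        _ ≤ n * t := mul_le_mul_of_nonneg_left ht.le (Nat.cast_nonneg n)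
    · rw [wordTail_scale A x w hq0 hAx (fun i hi => hwA i (mem_range.1 (mem_filter.1 hi).1))]
      exact hn t
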